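/- Let $\mathcal H(\mathbb C)$ be the space of entire functions with the topology of locally uniform convergence, let $D$ be the differentiation operator $Df=f'$ on $\mathcal H(\mathbb C)$, and for $\lambda\in\mathbb C$ put $\varphi_\lambda(z)=\lambda z$ and, for a positive integer $k$, $T_{\lambda,k}f=D^{k}(f\circ\varphi_\lambda)$, $f\in\mathcal H(\mathbb C)$. For a sequence $(S_n)$ of self-maps of $\mathcal H(\mathbb C)$ let $HC((S_n))$ be the set of all $f\in\mathcal H(\mathbb C)$ for which $\{S_nf:n\ge1\}$ is dense in $\mathcal H(\mathbb C)$. A subset of $\mathcal H(\mathbb C)$ is called residual if it contains a dense $G_\delta$ set. Let $(m_n)_{n\ge1}$ be a strictly increasing sequence of positive integers. 1. If $\sum_{n=1}^\infty 1/m_n<\infty$, then $\bigcap_{\lambda\in[\theta_1,\theta_2]}HC\big((T_{\lambda,m_n})_{n\ge1}\big)=\emptyset$ for all real numbers $0<\theta_1<\theta_2<\infty$. 2. If $\sum_{n=1}^\infty 1/m_n=\infty$, then $\bigcap_{\lambda\in(0,\infty)}HC\big((T_{\lambda,m_n})_{n\ge1}\big)$ is residual in $\mathcal H(\mathbb C)$.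 3. If $\sum_{n=1}^\infty 1/m_n=\infty$, then there is a set $I\subset\mathbb C\setminus\{0\}$ whose complement $\mathbb C\setminus I$ has two-dimensional Lebesgue measure zero and such that $\bigcap_{\lambda\in I}HC\big((T_{\lambda,m_n})_{n\ge1}\big)\neq\emptyset$. -/

import Mathlib

/-- The space `H(ℂ)` of entire functions, with the topology induced by the compact-open topology
of `C(ℂ, ℂ)`, that is, the topology of locally uniform convergence. -/
abbrev EntireFunctions : Type := {f : C(ℂ, ℂ) // Differentiable ℂ f}

namespace EntireFunctions

/-- Build an element of `H(ℂ)` from an everywhere complex differentiable function. -/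
noncomputable def of (f : ℂ → ℂ) (hf : Differentiable ℂ f) : EntireFunctions :=
  ⟨⟨f, hf.continuous⟩, hf⟩

theorem differentiable_deriv {f : ℂ → ℂ} (hf : Differentiable ℂ f) :
    Differentiable ℂ (deriv f) :=
  differentiableOn_univ.mp (hf.differentiableOn.deriv isOpen_univ)

/-- The differentiation operator `D f = f'` on `H(ℂ)`. -/
noncomputable def D (f : EntireFunctions) : EntireFunctions :=
  of (deriv f.1) (differentiable_deriv f.2)

/-- The operator `f ↦ f ∘ φ_c` on `H(ℂ)`, where `φ_c z = c * z`. -/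
noncomputable def compDilation (c : ℂ) (f : EntireFunctions) : EntireFunctions :=
  of (fun z => f.1 (c * z)) (f.2.comp (differentiable_id.const_mul c))

/-- The operator `T_{c,k} f = D^k (f ∘ φ_c)` on `H(ℂ)`, where `D^k` is the `k`-th iterate of `D`. -/
noncomputable def T (c : ℂ) (k : ℕ) (f : EntireFunctions) : EntireFunctions :=
  D^[k] (compDilation c f)

end EntireFunctions

/-- The set `HC((S_n))` of hypercyclic elements of a sequence of self-maps of a topological space:
the points `x` whose orbit `{S_n x : n}` is dense. -/
def hypercyclicSet {X : Type*} [TopologicalSpace X] (S : ℕ → X → X) : Set X :=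
  {x | Dense (Set.range fun n => S n x)}

/-- A residual set: one that contains a dense `G_δ` set. -/
def IsResidualSet {X : Type*} [TopologicalSpace X] (A : Set X) : Prop :=
  ∃ G : Set X, G ⊆ A ∧ IsGδ G ∧ Dense G

open Filter Topology Set Metric MeasureTheory


/-! ### Topology of the space of entire functions, and joint continuity of the operators. -/

namespace EntireFunctions

/-! Divergent case: perturb a polynomial `p` to `f = p + ∑ j, rightInverse (d j) (k j) q`. Applying
`T c (k i)` kills `p` and the terms `j < i`, since the gaps between orders exceed the degrees. The
terms `j > i` form a tail of an exponential series, provided `‖c‖ ≤ ‖d j‖`. What remains is `(c / d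
i) ^ k i * q (c / d i * z)`, close to `q` when `c / d i` and its `k i`-th power are close to 1
(`exists_forall_T_rightInverse_close`). For moduli this allows a ratio `exp (-δ / k)` between
consecutive radii; divergence of `∑ 1 / k` makes finitely many such annuli exhaust any `[a, b]`
(`exists_radii_forall_rotations`). Baire's theorem then gives residuality over the positive reals.

For complex `c` each annulus receives `L` orders, each with its own rotation. By pigeonhole a
rotation can be chosen to serve a fixed proportion of the parameters still missed
(`exists_measureReal_diff_directionSet_le`), so the missed measure decays like `θ ^ L`. Baire's
theorem yields one `f` whose exceptional set is null.

Convergent case: evaluating at 0 and taking logarithms puts `log c` in infinitely many intervals of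
length `4 / m n`, so Borel–Cantelli makes the admissible set of logarithms null. -/

/-- Locally uniform limits of holomorphic functions are holomorphic; closedness gives complete
metrizability, hence the Baire property. -/
theorem isClosedEmbedding_val :
    IsClosedEmbedding (Subtype.val : EntireFunctions → C(ℂ, ℂ)) := by
  refine ⟨.subtypeVal, ?_⟩
  rw [Subtype.range_val_subtype]
  refine isClosed_of_closure_subset fun f hf => ?_
  obtain ⟨u, hu, huf⟩ := mem_closure_iff_ultrafilter.mp hf
  have h : Tendsto id (u : Filter C(ℂ, ℂ)) (𝓝 f) := huf
  rw [ContinuousMap.tendsto_iff_tendstoLocallyUniformly, ← tendstoLocallyUniformlyOn_univ] at h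
  refine differentiableOn_univ.mp (h.differentiableOn ?_ isOpen_univ)
  filter_upwards [hu] with g hg using Differentiable.differentiableOn hg

instance : BaireSpace EntireFunctions := by
  have := isClosedEmbedding_val.IsCompletelyMetrizableSpace
  infer_instance

instance : SecondCountableTopology EntireFunctions :=
  isClosedEmbedding_val.isInducing.secondCountableTopology

theorem coe_D_iterate (k : ℕ) (f : EntireFunctions) (z : ℂ) :
    (D^[k] f).1 z = iteratedDeriv k f.1 z := by
  induction k generalizing f with
  | zero => simp
  | succ k ih =>
    rw [Function.iterate_succ_apply, ih, iteratedDeriv_succ']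
    rfl

theorem T_apply (c : ℂ) (k : ℕ) (f : EntireFunctions) (z : ℂ) :
    (T c k f).1 z = c ^ k * iteratedDeriv k f.1 (c * z) := by
  rw [T, coe_D_iterate]
  exact congrFun (iteratedDeriv_comp_const_mul f.2.contDiff c) z

theorem continuous_D : Continuous D := by
  rw [continuous_iff_continuousAt]
  intro f
  rw [ContinuousAt, tendsto_subtype_rng, ContinuousMap.tendsto_iff_tendstoLocallyUniformly,
    ← tendstoLocallyUniformlyOn_univ]
  refine TendstoLocallyUniformlyOn.deriv (F := fun g : EntireFunctions => (g.1 : ℂ → ℂ)) ?_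
    (Eventually.of_forall fun g => g.2.differentiableOn) isOpen_univ
  rw [tendstoLocallyUniformlyOn_univ, ← ContinuousMap.tendsto_iff_tendstoLocallyUniformly]
  exact continuous_subtype_val.continuousAt

theorem continuous_T (k : ℕ) : Continuous fun x : ℂ × EntireFunctions => T x.1 k x.2 := by
  refine (continuous_D.iterate k).comp (Continuous.subtype_mk (?_ : Continuous
    fun x : ℂ × EntireFunctions => (compDilation x.1 x.2).1) _)
  refine ContinuousMap.continuous_of_continuous_uncurry _ ?_
  have : Continuous fun y : (ℂ × EntireFunctions) × ℂ => y.1.2.1 (y.1.1 * y.2) :=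
    (continuous_eval (F := C(ℂ, ℂ))).comp
      ((continuous_subtype_val.comp (continuous_snd.comp continuous_fst)).prodMk
        ((continuous_fst.comp continuous_fst).mul continuous_snd))
  exact this

/-- The `f` such that for every `c ∈ K` some `T c (m n) f` lies in `U`. -/
def hittingSet (m : ℕ → ℕ) (K : Set ℂ) (U : Set EntireFunctions) : Set EntireFunctions :=
  {f | ∀ c ∈ K, ∃ n, T c (m n) f ∈ U}

/-- Joint continuity in `(c, f)` lets one `n` serve a neighbourhood of each `c`; compactness of `K`
does the rest. -/
theorem isOpen_hittingSet (m : ℕ → ℕ) {K : Set ℂ} (hK : IsCompact K) {U : Set EntireFunctions}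
    (hU : IsOpen U) : IsOpen (hittingSet m K U) := by
  rw [isOpen_iff_mem_nhds]
  intro f hf
  refine hK.eventually_forall_of_forall_eventually fun c hc => ?_
  obtain ⟨n, hn⟩ := hf c hc
  have h : Continuous fun x : EntireFunctions × ℂ => T x.2 (m n) x.1 :=
    (continuous_T (m n)).comp continuous_swap
  filter_upwards [h.continuousAt.preimage_mem_nhds (hU.mem_nhds hn)] with x hx using ⟨n, hx⟩

theorem exists_forall_norm_le_of_mem_nhds {f : EntireFunctions} {U : Set EntireFunctions}
    (hU : U ∈ 𝓝 f) : ∃ R > 0, ∃ ε > 0, ∀ g : EntireFunctions,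
      (∀ z : ℂ, ‖z‖ ≤ R → ‖g.1 z - f.1 z‖ ≤ ε) → g ∈ U := by
  rw [isClosedEmbedding_val.nhds_eq_comap, mem_comap] at hU
  obtain ⟨V, hV, hVU⟩ := hU
  obtain ⟨⟨K, ε⟩, ⟨hK, hε⟩, hKW⟩ := (nhds_basis_uniformity'
    (Metric.uniformity_basis_dist_le (α := ℂ)).compactConvergenceUniformity).mem_iff.mp hV
  obtain ⟨R, hR, hKR⟩ := hK.isBounded.subset_closedBall_lt 0 0
  refine ⟨R, hR, ε, hε, fun g hg => hVU (hKW fun z hz => ?_)⟩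
  have := hg z (by simpa using hKR hz)
  rwa [← dist_eq_norm, dist_comm] at this

/-- A polynomial as an entire function. -/
noncomputable def ofPolynomial (p : Polynomial ℂ) : EntireFunctions :=
  of (fun z => p.eval z) p.differentiable

theorem exists_ofPolynomial_mem {U : Set EntireFunctions} (hU : IsOpen U) (hne : U.Nonempty) :
    ∃ p, ofPolynomial p ∈ U := by
  obtain ⟨f, hf⟩ := hne
  obtain ⟨R, hR, ε, hε, h⟩ := exists_forall_norm_le_of_mem_nhds (hU.mem_nhds hf)
  lift R to NNReal using hR.le
  -- The radius 1 only fixes the Cauchy contour; the expansion converges on all of `ℂ`.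
  have hs := f.2.hasFPowerSeriesOnBall 0 (R := 1) one_pos
  obtain ⟨n, hn⟩ := (Metric.tendstoUniformlyOn_iff.mp
    (hs.tendstoUniformlyOn (r' := R + 1) (by simp)) ε hε).exists
  refine ⟨∑ i ∈ Finset.range n, Polynomial.monomial i ((cauchyPowerSeries f.1 0 1).coeff i),
    h _ fun z hz => ?_⟩
  have := hn z (by simpa using lt_of_le_of_lt hz (lt_add_one _))
  rw [dist_comm, dist_eq_norm, zero_add] at this
  refine le_of_eq_of_le ?_ this.le
  congr 2
  simp [ofPolynomial, of, FormalMultilinearSeries.partialSum, Polynomial.eval_finsetSum, mul_comm]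

end EntireFunctions

/-! ### Iterated antiderivatives of polynomials and their factorial decay. -/

namespace Polynomial

/-- The `k`-th iterated antiderivative of `q` all of whose derivatives of order less than `k`
vanish at `0`. -/
noncomputable def antiderivative (k : ℕ) (q : ℂ[X]) : ℂ[X] :=
  q.sum fun j a => monomial (j + k) (a * (j.factorial / (j + k).factorial))

theorem antiderivative_zero (q : ℂ[X]) : antiderivative 0 q = q := by
  conv_rhs => rw [← q.sum_monomial_eq]
  simp [antiderivative, Nat.factorial_ne_zero]

theorem derivative_antiderivative_succ (k : ℕ) (q : ℂ[X]) :
    derivative (antiderivative (k + 1) q) = antiderivative k q := by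
  simp only [antiderivative, Polynomial.sum, derivative_sum, derivative_monomial]
  refine Finset.sum_congr rfl fun j _ => ?_
  rw [← add_assoc, Nat.add_sub_cancel, Nat.factorial_succ]
  congr 1
  have h1 : ((j + k).factorial : ℂ) ≠ 0 := by exact_mod_cast Nat.factorial_ne_zero _
  have h2 : (j + k + 1 : ℂ) ≠ 0 := by exact_mod_cast Nat.succ_ne_zero (j + k)
  push_cast
  field_simp

theorem iterate_derivative_antiderivative (k i : ℕ) (q : ℂ[X]) :
    derivative^[i] (antiderivative (k + i) q) = antiderivative k q := by
  induction i with
  | zero => rfl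
  | succ i ih =>
    rw [Function.iterate_succ_apply, ← add_assoc, derivative_antiderivative_succ, ih]

theorem iterate_derivative_comp_C_mul_X (a : ℂ) (i : ℕ) (q : ℂ[X]) :
    derivative^[i] (q.comp (C a * X)) = C (a ^ i) * (derivative^[i] q).comp (C a * X) := by
  induction i generalizing q with
  | zero => simp
  | succ i ih =>
    rw [Function.iterate_succ_apply, derivative_comp, derivative_C_mul, derivative_X, mul_one,
      iterate_derivative_C_mul, ih, Function.iterate_succ_apply, pow_succ', C_mul]
    ring

/-- The majorant `∑ ‖q_j‖ ρ ^ j` of `q` on the disc of radius `ρ`. -/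
noncomputable def majorant (q : ℂ[X]) (ρ : ℝ) : ℝ := q.sum fun j a => ‖a‖ * ρ ^ j

theorem majorant_nonneg (q : ℂ[X]) {ρ : ℝ} (hρ : 0 ≤ ρ) : 0 ≤ q.majorant ρ :=
  Finset.sum_nonneg fun _ _ => by positivity

theorem norm_eval_antiderivative_le (k : ℕ) (q : ℂ[X]) {w : ℂ} {ρ : ℝ} (hw : ‖w‖ ≤ ρ) :
    ‖(antiderivative k q).eval w‖ ≤ q.majorant ρ * (ρ ^ k / k.factorial) := by
  rw [antiderivative, majorant, Polynomial.sum, Polynomial.sum, eval_finsetSum, Finset.sum_mul]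
  refine (norm_sum_le _ _).trans (Finset.sum_le_sum fun j _ => ?_)
  rw [eval_monomial, norm_mul, norm_mul, norm_div, norm_pow, Complex.norm_natCast,
    Complex.norm_natCast, mul_assoc, mul_assoc]
  have h0 : 0 ≤ ρ := (norm_nonneg w).trans hw
  have h1 : (j.factorial : ℝ) / (j + k).factorial ≤ 1 / k.factorial := by
    rw [div_le_div_iff₀ (by positivity) (by positivity), one_mul]
    exact_mod_cast Nat.le_of_dvd (Nat.factorial_pos _)
      (Nat.factorial_mul_factorial_dvd_factorial_add _ _)
  calc _ ≤ ‖q.coeff j‖ * (1 / k.factorial * ρ ^ (j + k)) := by gcongr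
    _ = _ := by rw [pow_add]; ring

end Polynomial

/-! ### Right inverses and the perturbed polynomial. -/

namespace EntireFunctions

open Polynomial

theorem T_ofPolynomial (c : ℂ) (k : ℕ) (p : ℂ[X]) (z : ℂ) :
    (T c k (ofPolynomial p)).1 z = c ^ k * (derivative^[k] p).eval (c * z) := by
  rw [T_apply]
  congr 1
  have h : iteratedDeriv k (fun z => p.eval z) = fun z => (derivative^[k] p).eval z := by
    induction k generalizing p with
    | zero => simp
    | succ k ih =>
      rw [iteratedDeriv_succ', Function.iterate_succ_apply, ← ih]
      congr 1
      ext z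
      exact p.deriv
  exact congrFun h (c * z)

/-- The right inverse of `T c k` that maps `q` to the polynomial vanishing at `0` to order `k`. -/
noncomputable def rightInverse (c : ℂ) (k : ℕ) (q : ℂ[X]) : ℂ[X] :=
  (antiderivative k q).comp (C c⁻¹ * X)

theorem T_rightInverse_add (c d : ℂ) (k i : ℕ) (q : ℂ[X]) (z : ℂ) :
    (c ^ i * (derivative^[i] (rightInverse d (k + i) q)).eval (c * z)) =
      (c / d) ^ i * (antiderivative k q).eval (c / d * z) := by
  rw [rightInverse, iterate_derivative_comp_C_mul_X, iterate_derivative_antiderivative,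
    eval_mul, eval_C, eval_comp, eval_mul, eval_C, eval_X, div_eq_mul_inv, mul_pow, mul_assoc]
  congr 3
  ring

theorem iterate_derivative_rightInverse_eq_zero (d : ℂ) {k i : ℕ} {q : ℂ[X]}
    (h : k + q.natDegree < i) : derivative^[i] (rightInverse d k q) = 0 := by
  obtain ⟨l, rfl⟩ := Nat.exists_eq_add_of_lt h
  rw [rightInverse, iterate_derivative_comp_C_mul_X,
    show k + q.natDegree + l + 1 = (q.natDegree + l + 1) + k by ring, Function.iterate_add_apply]
  have := iterate_derivative_antiderivative 0 k q
  rw [zero_add, antiderivative_zero] at this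
  rw [this, iterate_derivative_eq_zero (by omega)]
  simp

/-- `N` depends on neither the orders `k`, the scales `d` nor the number `r` of terms, so these can
be chosen afterwards. -/
theorem exists_forall_T_rightInverse_close (p q : ℂ[X]) {R a ε : ℝ} (hR : 0 < R) (ha : 0 < a)
    (hε : 0 < ε) : ∃ N : ℕ, ∀ (k : ℕ → ℕ) (d : ℕ → ℂ) (r : ℕ), StrictMono k →
      (∀ i j, i < j → k i + N ≤ k j) → (∀ i, N ≤ k i) → (∀ i, a ≤ ‖d i‖) →
      ∃ f : ℂ[X], (∀ z, ‖z‖ ≤ R → ‖f.eval z - p.eval z‖ ≤ ε) ∧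
        ∀ i < r, ∀ c, (∀ j, i < j → j < r → ‖c‖ ≤ ‖d j‖) → ∀ z, ‖z‖ ≤ R →
          ‖(T c (k i) (ofPolynomial f)).1 z - (c / d i) ^ k i * q.eval (c / d i * z)‖ ≤ ε := by
  -- `R / a` bounds `z / d j` in the estimate of `f - p`; `R` bounds `c / d j * z` in the other.
  set ρ := max R (R / a) with hρ
  have hρ0 : 0 < ρ := lt_max_of_lt_left hR
  set u : ℕ → ℝ := fun l => q.majorant ρ * (ρ ^ l / l.factorial) with hu
  have hsum : Summable u := (Real.summable_pow_div_factorial ρ).mul_left _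
  obtain ⟨s, hs⟩ := summable_iff_vanishing_norm.mp hsum ε hε
  have hu0 : ∀ l, 0 ≤ u l := fun l => mul_nonneg (majorant_nonneg q hρ0.le) (by positivity)
  obtain ⟨N₀, hN₀⟩ : ∃ N₀, ∀ l ∈ s, l < N₀ :=
    ⟨s.sup id + 1, fun l hl => Nat.lt_succ_of_le (Finset.le_sup (f := id) hl)⟩
  -- Used with `g = k` for `f - p`, and with `g j = k j - k i` after `k i` differentiations.
  have htail : ∀ (t : Finset ℕ) (g : ℕ → ℕ), Set.InjOn g t → (∀ j ∈ t, N₀ ≤ g j) →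
      ∑ j ∈ t, u (g j) ≤ ε := by
    intro t g hg ht
    rw [← Finset.sum_image (f := u) hg]
    refine (le_abs_self _).trans (hs _ ?_).le
    rw [Finset.disjoint_left]
    intro l hl hls
    obtain ⟨j, hj, rfl⟩ := Finset.mem_image.mp hl
    exact absurd (hN₀ _ hls) (not_lt.mpr (ht j hj))
  refine ⟨max N₀ (max (p.natDegree + 1) (q.natDegree + 1)), fun k d r hk hgap hN hd => ?_⟩
  simp only [max_le_iff] at hN
  have hgap' : ∀ i j, i < j → N₀ ≤ k j - k i ∧ q.natDegree + k i < k j := fun i j hij => by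
    have := hgap i j hij
    omega
  refine ⟨p + ∑ j ∈ Finset.range r, rightInverse (d j) (k j) q, fun z hz => ?_,
    fun i hi c hc z hz => ?_⟩
  · rw [eval_add, add_sub_cancel_left, eval_finsetSum]
    refine (norm_sum_le _ _).trans ((Finset.sum_le_sum fun j _ => ?_).trans
      (htail (Finset.range r) k hk.injective.injOn fun j _ => (hN j).1))
    rw [rightInverse, eval_comp, eval_mul, eval_C, eval_X]
    refine norm_eval_antiderivative_le _ _ (le_max_of_le_right ?_)
    rw [norm_mul, norm_inv, mul_comm, ← div_eq_mul_inv]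
    exact div_le_div₀ hR.le hz ha (hd j)
  · rw [T_ofPolynomial, iterate_map_add, iterate_derivative_sum,
      iterate_derivative_eq_zero (p := p) (by have := (hN i).2.1; omega), zero_add,
      eval_finsetSum, Finset.mul_sum, ← Finset.add_sum_erase _ _ (Finset.mem_range.mpr hi)]
    have hmain := T_rightInverse_add c (d i) 0 (k i) q z
    rw [zero_add, antiderivative_zero] at hmain
    rw [hmain, add_sub_cancel_left]
    rw [← Finset.sum_filter_add_sum_filter_not _ (fun j => i < j),
      Finset.sum_eq_zero (s := Finset.filter (fun j => ¬ i < j) _), add_zero]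
    · refine (norm_sum_le _ _).trans ((Finset.sum_le_sum fun j hj => ?_).trans
        (htail _ (fun j => k j - k i) ?_ fun j hj => ?_))
      · obtain ⟨hj1, hij⟩ := Finset.mem_filter.mp hj
        have hjr := Finset.mem_range.mp (Finset.mem_of_mem_erase hj1)
        obtain ⟨l, hl⟩ := Nat.exists_eq_add_of_lt (hk hij)
        have hkl : k j = (l + 1) + k i := by omega
        have hcd : ‖c / d j‖ ≤ 1 := by
          rw [norm_div]
          exact div_le_one_of_le₀ (hc j hij hjr) (norm_nonneg _)
        rw [hkl, T_rightInverse_add, norm_mul, norm_pow, Nat.add_sub_cancel]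
        refine (mul_le_of_le_one_left (norm_nonneg _) (pow_le_one₀ (norm_nonneg _) hcd)).trans
          (norm_eval_antiderivative_le _ _ (le_max_of_le_left ?_))
        rw [norm_mul]
        exact (mul_le_of_le_one_left (norm_nonneg _) hcd).trans hz
      · intro x hx y hy hxy
        have h1 := hk (Finset.mem_filter.mp hx).2
        have h2 := hk (Finset.mem_filter.mp hy).2
        have hxy' : k x - k i = k y - k i := hxy
        exact hk.injective (by omega)
      · exact (hgap' i j (Finset.mem_filter.mp hj).2).1
    · intro j hj
      obtain ⟨hj1, hij⟩ := Finset.mem_filter.mp hj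
      have hji : j < i := lt_of_le_of_ne (not_lt.mp hij) (Finset.ne_of_mem_erase hj1)
      rw [iterate_derivative_rightInverse_eq_zero _ (by have := (hgap' j i hji).2; omega)]
      simp

theorem exists_forall_norm_mul_eval_sub_le (q : ℂ[X]) {R ε : ℝ} (hε : 0 < ε) :
    ∃ δ > 0, ∀ w u : ℂ, ‖w - 1‖ < δ → ‖u - 1‖ < δ → ∀ z, ‖z‖ ≤ R →
      ‖u * q.eval (w * z) - q.eval z‖ ≤ ε := by
  have h : ∀ᶠ x : ℂ × ℂ in 𝓝 (1, 1), ∀ z ∈ closedBall (0 : ℂ) R,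
      ‖x.2 * q.eval (x.1 * z) - q.eval z‖ < ε := by
    refine (isCompact_closedBall 0 R).eventually_forall_of_forall_eventually fun z _ => ?_
    have hc : Continuous fun y : (ℂ × ℂ) × ℂ =>
        ‖y.1.2 * q.eval (y.1.1 * y.2) - q.eval y.2‖ := by fun_prop
    exact hc.continuousAt.eventually_lt continuousAt_const (by simpa using hε)
  obtain ⟨δ, hδ, h⟩ := Metric.eventually_nhds_iff.mp h
  refine ⟨δ, hδ, fun w u hw hu z hz => (h (y := (w, u)) ?_ z (by simpa using hz)).le⟩
  rw [Prod.dist_eq]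
  simpa [dist_eq_norm] using ⟨hw, hu⟩

end EntireFunctions

/-! ### Choice of orders and radii from the divergent series. -/

/-- A nonsummable antitone sequence stays nonsummable along every arithmetic progression, so taking
every `(N + 1)`-th order, and then every `L`-th of these, loses nothing. -/
theorem exists_sparse_subsequence {m : ℕ → ℕ} (hm : StrictMono m) (hpos : ∀ n, 0 < m n)
    (hns : ¬ Summable fun n => 1 / (m n : ℝ)) (N : ℕ) {L : ℕ} (hL : 0 < L) :
    ∃ k : ℕ → ℕ, (∀ i, k i ∈ range m) ∧ StrictMono k ∧ (∀ i j, i < j → k i + N ≤ k j) ∧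
      (∀ i, N ≤ k i) ∧ ¬ Summable fun g => 1 / (k ((g + 1) * L) : ℝ) := by
  have hmono : StrictMono fun i => (N + 1) * (i + 1) := fun i j hij => by dsimp only; gcongr
  refine ⟨fun i => m ((N + 1) * (i + 1)), fun i => mem_range_self _, hm.comp hmono,
    fun i j hij => ?_, fun i => ?_, fun hs => hns ?_⟩
  · obtain ⟨l, rfl⟩ := Nat.exists_eq_add_of_lt hij
    have := hm.add_le_nat ((N + 1) * (l + 1)) ((N + 1) * (i + 1))
    dsimp only
    rw [show (N + 1) * (i + l + 1 + 1) = (N + 1) * (l + 1) + (N + 1) * (i + 1) by ring]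
    have h2 : N ≤ (N + 1) * (l + 1) := by nlinarith
    linarith
  · exact le_trans (by nlinarith) (hm.le_apply (x := (N + 1) * (i + 1)))
  · have : NeZero ((N + 1) * L) := ⟨by positivity⟩
    have hanti : Antitone fun n => 1 / (m n : ℝ) := fun i j hij => by
      have := hpos i
      have := hm.monotone hij
      dsimp only
      gcongr
    rw [← summable_indicator_mod_iff hanti (((N + 1) * L + (N + 1) : ℕ) : ZMod ((N + 1) * L)),
      summable_indicator_mod_iff_summable]
    refine (summable_congr fun g => ?_).mpr hs
    rw [show (N + 1) * L * g + ((N + 1) * L + (N + 1)) = (N + 1) * ((g + 1) * L + 1) by ring]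

theorem exists_lt_mul_exp_sum {x : ℕ → ℝ} (hx : ∀ i, 0 ≤ x i) (hs : ¬ Summable x) {a : ℝ}
    (ha : 0 < a) (b : ℝ) : ∃ r, b < a * Real.exp (∑ i ∈ Finset.range r, x i) := by
  have h := (Real.tendsto_exp_atTop.comp
    ((not_summable_iff_tendsto_nat_atTop_of_nonneg hx).mp hs)).const_mul_atTop ha
  exact (h.eventually_gt_atTop b).exists

theorem exists_lt_mem_Ico_of_lt {ρ : ℕ → ℝ} {t : ℝ} {r : ℕ} (h0 : ρ 0 ≤ t) (hr : t < ρ r) :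
    ∃ g < r, t ∈ Ico (ρ g) (ρ (g + 1)) := by
  induction r with
  | zero => exact absurd hr (not_lt.mpr h0)
  | succ r ih =>
    by_cases h : t < ρ r
    · obtain ⟨g, hg, hgt⟩ := ih h
      exact ⟨g, hg.trans (Nat.lt_succ_self r), hgt⟩
    · exact ⟨r, Nat.lt_succ_self r, not_lt.mp h, hr⟩

theorem norm_real_mul_sub_one_lt {t η δ : ℝ} {v : ℂ} (ht : t ≤ 1) (ht' : 1 - η ≤ t)
    (hv : ‖v‖ = 1) (hv' : ‖v - 1‖ < δ) : ‖(t : ℂ) * v - 1‖ < η + δ := by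
  have h : (t : ℂ) * v - 1 = ((t - 1 : ℝ) : ℂ) * v + (v - 1) := by push_cast; ring
  rw [h]
  refine (norm_add_le _ _).trans_lt ?_
  rw [norm_mul, hv, mul_one, Complex.norm_real, Real.norm_eq_abs, abs_of_nonpos (by linarith)]
  linarith

namespace EntireFunctions

open Polynomial

/-- The order of quantifiers matters: `δ` precedes `L`, so that `L` may depend on the covering
proportion attached to `δ`; the rotations come after the orders. -/
theorem exists_radii_forall_rotations {m : ℕ → ℕ} (hm : StrictMono m) (hpos : ∀ n, 0 < m n)
    (hns : ¬ Summable fun n => 1 / (m n : ℝ)) (p q : ℂ[X]) {R a ε : ℝ} (hR : 0 < R) (ha : 0 < a)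
    (hε : 0 < ε) (b : ℝ) : ∃ δ > 0, ∀ L > 0, ∃ (k : ℕ → ℕ) (ρ : ℕ → ℝ) (r : ℕ),
      (∀ i, k i ∈ range m) ∧ Monotone ρ ∧ ρ 0 = a ∧ b < ρ r ∧
      ∀ ω : ℕ → ℂ, (∀ i, ‖ω i‖ = 1) → ∃ f : ℂ[X], (∀ z, ‖z‖ ≤ R → ‖f.eval z - p.eval z‖ ≤ ε) ∧
        ∀ g < r, ∀ l < L, ∀ (s : ℝ) (u : ℂ), s ∈ Icc (ρ g) (ρ (g + 1)) → ‖u‖ = 1 →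
          ‖u / ω (g * L + l) - 1‖ < δ → ‖(u / ω (g * L + l)) ^ k (g * L + l) - 1‖ < δ →
          ∀ z, ‖z‖ ≤ R →
            ‖(T (s * u) (k (g * L + l)) (ofPolynomial f)).1 z - q.eval z‖ ≤ ε := by
  obtain ⟨δ, hδ, hclose⟩ := exists_forall_norm_mul_eval_sub_le q (R := R) (half_pos hε)
  obtain ⟨N, hN⟩ := exists_forall_T_rightInverse_close p q hR ha (half_pos hε)
  refine ⟨δ / 2, half_pos hδ, fun L hL => ?_⟩
  obtain ⟨k, hkm, hk, hgap, hkN, hks⟩ := exists_sparse_subsequence hm hpos hns N hL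
  -- `k ((g + 1) * L)` exceeds every order of block `g`, so one step size suits all `L` of them.
  set x : ℕ → ℝ := fun g => δ / 2 * (1 / (k ((g + 1) * L) : ℝ)) with hx
  have hx0 : ∀ g, 0 ≤ x g := fun g => by positivity
  have hxs : ¬ Summable x := by rwa [summable_mul_left_iff (half_pos hδ).ne']
  set ρ : ℕ → ℝ := fun g => a * Real.exp (∑ h ∈ Finset.range g, x h) with hρ
  have hρm : Monotone ρ := monotone_nat_of_le_succ fun g => by
    simp only [hρ, Finset.sum_range_succ]
    gcongr
    linarith [hx0 g]
  have hρ0 : ρ 0 = a := by simp [hρ]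
  have hρa : ∀ g, a ≤ ρ g := fun g => hρ0 ▸ hρm (Nat.zero_le g)
  obtain ⟨r, hr⟩ := exists_lt_mul_exp_sum hx0 hxs ha b
  refine ⟨k, ρ, r, hkm, hρm, hρ0, hr, fun ω hω => ?_⟩
  have hd : ∀ i, ‖(ρ (i / L + 1) : ℂ) * ω i‖ = ρ (i / L + 1) := fun i => by
    rw [norm_mul, hω, mul_one, Complex.norm_real, Real.norm_eq_abs,
      abs_of_pos (ha.trans_le (hρa _))]
  -- The scale sits on the outer radius of its annulus, so `‖c‖ ≤ ‖d j‖` holds for all later `j`,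
  -- including those of the same block.
  obtain ⟨f, hfp, hf⟩ := hN k (fun i => ρ (i / L + 1) * ω i) (r * L) hk hgap hkN
    fun i => by rw [hd]; exact hρa _
  refine ⟨f, fun z hz => (hfp z hz).trans (half_le_self hε.le),
    fun g hg l hl s u hs hu h1 h2 z hz => ?_⟩
  set i := g * L + l with hi
  have hiL : i / L = g := by
    rw [hi, mul_comm, Nat.mul_add_div hL, Nat.div_eq_of_lt hl, add_zero]
  have hir : i < r * L := by nlinarith
  have hs0 : 0 < s := ha.trans_le ((hρa g).trans hs.1)
  have hsu : ‖(s : ℂ) * u‖ = s := by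
    rw [norm_mul, hu, mul_one, Complex.norm_real, Real.norm_eq_abs, abs_of_pos hs0]
  have hT := hf i hir (s * u) (fun j hij hjr => by
    rw [hsu, hd]
    refine hs.2.trans (hρm ?_)
    rw [← hiL]
    exact Nat.succ_le_succ (Nat.div_le_div_right hij.le)) z hz
  set t : ℝ := s / ρ (g + 1) with ht
  set v : ℂ := u / ω i with hv
  have hv1 : ‖v‖ = 1 := by rw [hv, norm_div, hu, hω, div_one]
  have hdiv : (s * u : ℂ) / (ρ (i / L + 1) * ω i) = t * v := by
    rw [hiL, ht, hv]
    push_cast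
    exact mul_div_mul_comm _ _ _ _
  rw [hdiv] at hT
  have hρg : 0 < ρ (g + 1) := ha.trans_le (hρa _)
  have ht1 : t ≤ 1 := div_le_one_of_le₀ hs.2 hρg.le
  have htx : Real.exp (-x g) ≤ t := by
    rw [ht, le_div_iff₀ hρg]
    refine le_trans (le_of_eq ?_) hs.1
    simp only [hρ, Finset.sum_range_succ, Real.exp_add, Real.exp_neg]
    field_simp
  have hkg : k i ≤ k ((g + 1) * L) := hk.monotone (by rw [hi, add_mul]; omega)
  have hkpos : 0 < k ((g + 1) * L) := lt_of_lt_of_le (by positivity) hk.le_apply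
  -- Needed for `n = 1` (the argument of `q`) and `n = k i` (the factor in front).
  have hxk : ∀ n : ℕ, n ≤ k ((g + 1) * L) → 1 - δ / 2 ≤ t ^ n := fun n hn => by
    have h3 : n * x g ≤ δ / 2 := by
      rw [hx]
      dsimp only
      rw [mul_left_comm, mul_one_div]
      refine mul_le_of_le_one_right (half_pos hδ).le (div_le_one_of_le₀ ?_ (by positivity))
      exact_mod_cast hn
    calc 1 - δ / 2 ≤ -(n * x g) + 1 := by linarith
      _ ≤ Real.exp (-(n * x g)) := Real.add_one_le_exp _
      _ = Real.exp (-x g) ^ n := by rw [← Real.exp_nat_mul]; ring_nf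
      _ ≤ t ^ n := by gcongr
  have hw := norm_real_mul_sub_one_lt ht1 (by simpa using hxk 1 hkpos) hv1 h1
  have ht0 : 0 ≤ t := (Real.exp_pos _).le.trans htx
  have hw' := norm_real_mul_sub_one_lt (pow_le_one₀ ht0 ht1) (hxk (k i) hkg)
    (by rw [norm_pow, hv1, one_pow]) h2
  rw [Complex.ofReal_pow, ← mul_pow] at hw'
  rw [add_halves] at hw hw'
  have := norm_add_le_of_le hT (hclose _ _ hw hw' z hz)
  rwa [sub_add_sub_cancel, add_halves] at this

end EntireFunctions

/-! ### Covering most directions by rotations. -/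

/-- The nonzero `c` whose direction `u = c / ‖c‖` satisfies `u / w ≈ 1` and `(u / w) ^ k ≈ 1`,
up to `δ`. -/
def directionSet (δ : ℝ) (w : ℂ) (k : ℕ) : Set ℂ :=
  {c | c ≠ 0 ∧ ‖c / ‖c‖ / w - 1‖ < δ ∧ ‖(c / ‖c‖ / w) ^ k - 1‖ < δ}

theorem measurableSet_directionSet (δ : ℝ) (w : ℂ) (k : ℕ) :
    MeasurableSet (directionSet δ w k) := by
  have h : Measurable fun c : ℂ => c / ‖c‖ / w := by fun_prop
  exact (measurableSet_singleton 0).compl.inter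
    ((measurableSet_lt (h.sub_const 1).norm measurable_const).inter
      (measurableSet_lt ((h.pow_const k).sub_const 1).norm measurable_const))

theorem norm_div_norm_self {c : ℂ} (hc : c ≠ 0) : ‖c / ‖c‖‖ = 1 := by
  rw [norm_div, Complex.norm_real, norm_norm, div_self (norm_ne_zero_iff.mpr hc)]

/-- The pairs `(u, u ^ k)` lie in a compact bidisc, covered by a number of `δ / 2`-balls independent
of `k`. One ball carries a fixed share of `E`; the direction of any point of `E` in that share
serves as `w`. -/
theorem exists_measureReal_diff_directionSet_le {δ : ℝ} (hδ : 0 < δ) :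
    ∃ θ : ℝ, 0 ≤ θ ∧ θ < 1 ∧ ∀ (μ : Measure ℂ) (E : Set ℂ) (k : ℕ), MeasurableSet E → μ E ≠ ⊤ →
      0 ∉ E → ∃ w : ℂ, ‖w‖ = 1 ∧ μ.real (E \ directionSet δ w k) ≤ θ * μ.real E := by
  obtain ⟨S, hS, hSf, hcover⟩ := ((isCompact_closedBall (0 : ℂ) 1).prod
    (isCompact_closedBall (0 : ℂ) 1)).finite_cover_balls (half_pos hδ)
  lift S to Finset (ℂ × ℂ) using hSf
  -- The extra 1 makes the pigeonhole inequality strict.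
  refine ⟨1 - 1 / (S.card + 1), ?_, ?_, fun μ E k hE hμ h0 => ?_⟩
  · rw [sub_nonneg]
    exact div_le_one_of_le₀ (by linarith [Nat.cast_nonneg (α := ℝ) S.card]) (by positivity)
  · have : (0 : ℝ) < 1 / (S.card + 1) := by positivity
    linarith
  by_cases hE0 : μ.real E = 0
  · refine ⟨1, norm_one, ?_⟩
    rw [hE0, mul_zero, ← hE0]
    exact measureReal_mono sdiff_subset hμ
  have hEpos : 0 < μ.real E := lt_of_le_of_ne measureReal_nonneg (Ne.symm hE0)
  have hunit : ∀ c ∈ E, c ≠ 0 := fun c hc h => h0 (h ▸ hc)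
  obtain ⟨s, hs, hsE⟩ : ∃ s ∈ S, μ.real E / (S.card + 1) ≤
      μ.real (E ∩ {c | (c / ‖c‖, (c / ‖c‖) ^ k) ∈ ball s (δ / 2)}) := by
    by_contra! hlt
    have hsub : E ⊆ ⋃ s ∈ S, E ∩ {c | (c / ‖c‖, (c / ‖c‖) ^ k) ∈ ball s (δ / 2)} := by
      intro c hc
      have hn := norm_div_norm_self (hunit c hc)
      have : (c / ‖c‖, (c / ‖c‖) ^ k) ∈ closedBall (0 : ℂ) 1 ×ˢ closedBall (0 : ℂ) 1 :=
        ⟨(mem_closedBall_zero_iff.mpr hn.le : c / ‖c‖ ∈ _), by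
          rw [mem_closedBall_zero_iff, norm_pow, hn, one_pow]⟩
      obtain ⟨s, hs, hcs⟩ := mem_iUnion₂.mp (hcover this)
      exact mem_iUnion₂.mpr ⟨s, hs, hc, hcs⟩
    have h1 : μ.real E ≤ S.card • (μ.real E / (S.card + 1)) :=
      ((measureReal_mono hsub (measure_biUnion_lt_top S.finite_toSet fun s _ =>
        (measure_mono inter_subset_left).trans_lt hμ.lt_top).ne).trans
        (measureReal_biUnion_finset_le _ _)).trans
        (Finset.sum_le_card_nsmul _ _ _ fun s hs => (hlt s hs).le)
    rw [nsmul_eq_mul, mul_div_assoc', le_div_iff₀ (by positivity)] at h1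
    linarith
  have hpos : 0 < μ.real (E ∩ {c | (c / ‖c‖, (c / ‖c‖) ^ k) ∈ ball s (δ / 2)}) :=
    lt_of_lt_of_le (by positivity) hsE
  obtain ⟨c₀, hc₀, hc₀s⟩ : (E ∩ {c | (c / ‖c‖, (c / ‖c‖) ^ k) ∈ ball s (δ / 2)}).Nonempty := by
    rw [nonempty_iff_ne_empty]
    intro h
    rw [h, measureReal_empty] at hpos
    exact lt_irrefl _ hpos
  set w : ℂ := c₀ / ‖c₀‖ with hw
  have hw1 : ‖w‖ = 1 := norm_div_norm_self (hunit c₀ hc₀)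
  have hw0 : w ≠ 0 := norm_ne_zero_iff.mp (by rw [hw1]; exact one_ne_zero)
  have hsub : E ∩ {c | (c / ‖c‖, (c / ‖c‖) ^ k) ∈ ball s (δ / 2)} ⊆ E ∩ directionSet δ w k := by
    rintro c ⟨hc, hcs⟩
    have hd : dist (c / ‖c‖, (c / ‖c‖) ^ k) (w, w ^ k) < δ := by
      have := (dist_triangle_right _ _ s).trans_lt (add_lt_add hcs hc₀s)
      rwa [add_halves] at this
    rw [Prod.dist_eq, max_lt_iff, dist_eq_norm, dist_eq_norm] at hd
    refine ⟨hc, hunit c hc, ?_, ?_⟩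
    · rw [div_sub_one hw0, norm_div, hw1, div_one]
      exact hd.1
    · rw [div_pow, div_sub_one (pow_ne_zero k hw0), norm_div, norm_pow, hw1, one_pow, div_one]
      exact hd.2
  refine ⟨w, hw1, ?_⟩
  have h1 := measureReal_sdiff_add_inter (s := E) (measurableSet_directionSet δ w k) hμ
  have h2 := hsE.trans (measureReal_mono hsub (ne_top_of_le_ne_top hμ
    (measure_mono inter_subset_left)))
  rw [sub_mul, one_mul, one_div_mul_eq_div]
  linarith

theorem exists_measureReal_diff_iUnion_directionSet_le {δ θ : ℝ} (hθ : 0 ≤ θ) {μ : Measure ℂ}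
    (h : ∀ (E : Set ℂ) (k : ℕ), MeasurableSet E → μ E ≠ ⊤ → 0 ∉ E →
      ∃ w : ℂ, ‖w‖ = 1 ∧ μ.real (E \ directionSet δ w k) ≤ θ * μ.real E)
    {E : Set ℂ} (hE : MeasurableSet E) (hμ : μ E ≠ ⊤) (h0 : 0 ∉ E) (k : ℕ → ℕ) (L : ℕ) :
    ∃ w : ℕ → ℂ, (∀ l, ‖w l‖ = 1) ∧
      μ.real (E \ ⋃ l < L, directionSet δ (w l) (k l)) ≤ θ ^ L * μ.real E := by
  induction L with
  | zero => exact ⟨fun _ => 1, fun _ => norm_one, by simp⟩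
  | succ L ih =>
    obtain ⟨w, hw, hwE⟩ := ih
    have hm : MeasurableSet (E \ ⋃ l < L, directionSet δ (w l) (k l)) :=
      hE.diff (.iUnion fun l => .iUnion fun _ => measurableSet_directionSet _ _ _)
    obtain ⟨v, hv, hvE⟩ := h _ (k L) hm (ne_top_of_le_ne_top hμ (measure_mono sdiff_subset))
      fun hc => h0 hc.1
    refine ⟨Function.update w L v, fun l => ?_, ?_⟩
    · rcases eq_or_ne l L with rfl | hl
      · simpa using hv
      · simpa [hl] using hw l
    · have hset : E \ ⋃ l < L + 1, directionSet δ (Function.update w L v l) (k l) =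
          (E \ ⋃ l < L, directionSet δ (w l) (k l)) \ directionSet δ v (k L) := by
        rw [biUnion_lt_succ, sdiff_sdiff, Function.update_self]
        congr 2
        refine iUnion₂_congr fun l hl => ?_
        rw [Function.update_of_ne hl.ne]
      rw [hset, pow_succ', mul_assoc]
      exact hvE.trans (mul_le_mul_of_nonneg_left hwE hθ)

/-! ### Density of the hitting sets and the Baire arguments. -/

namespace EntireFunctions

open Polynomial

theorem dense_of_forall_ofPolynomial {G : Set EntireFunctions}
    (h : ∀ p : ℂ[X], ∀ R > 0, ∀ ε > 0,
      ∃ f ∈ G, ∀ z, ‖z‖ ≤ R → ‖f.1 z - p.eval z‖ ≤ ε) : Dense G := by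
  rw [dense_iff_inter_open]
  intro V hV hVne
  obtain ⟨p, hp⟩ := exists_ofPolynomial_mem hV hVne
  obtain ⟨R, hR, ε, hε, hV'⟩ := exists_forall_norm_le_of_mem_nhds (hV.mem_nhds hp)
  obtain ⟨f, hf, hfp⟩ := h p R hR ε hε
  exact ⟨f, hV' f hfp, hf⟩

variable {m : ℕ → ℕ} {U : Set EntireFunctions}

theorem exists_radii_forall_rotations_mem (hm : StrictMono m) (hpos : ∀ n, 0 < m n)
    (hns : ¬ Summable fun n => 1 / (m n : ℝ)) (hU : IsOpen U) (hne : U.Nonempty) (p : ℂ[X])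
    {R a ε : ℝ} (hR : 0 < R) (ha : 0 < a) (hε : 0 < ε) (b : ℝ) :
    ∃ δ > 0, ∀ L > 0, ∃ (k : ℕ → ℕ) (ρ : ℕ → ℝ) (r : ℕ), Monotone ρ ∧ ρ 0 = a ∧ b < ρ r ∧
      ∀ ω : ℕ → ℂ, (∀ i, ‖ω i‖ = 1) →
        ∃ f : EntireFunctions, (∀ z, ‖z‖ ≤ R → ‖f.1 z - p.eval z‖ ≤ ε) ∧
          ∀ g < r, ∀ l < L, ∀ c : ℂ, ‖c‖ ∈ Ico (ρ g) (ρ (g + 1)) →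
            c ∈ directionSet δ (ω (g * L + l)) (k (g * L + l)) → ∃ n, T c (m n) f ∈ U := by
  obtain ⟨q, hq⟩ := exists_ofPolynomial_mem hU hne
  obtain ⟨R', hR', ε', hε', hU'⟩ := exists_forall_norm_le_of_mem_nhds (hU.mem_nhds hq)
  obtain ⟨δ, hδ, h⟩ := exists_radii_forall_rotations hm hpos hns p q (lt_max_of_lt_left hR) ha
    (lt_min hε hε') b (R := max R R')
  refine ⟨δ, hδ, fun L hL => ?_⟩
  obtain ⟨k, ρ, r, hkm, hρ, hρ0, hr, h⟩ := h L hL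
  refine ⟨k, ρ, r, hρ, hρ0, hr, fun ω hω => ?_⟩
  obtain ⟨f, hfp, hf⟩ := h ω hω
  refine ⟨ofPolynomial f, fun z hz => (hfp z (le_max_of_le_left hz)).trans (min_le_left _ _),
    fun g hg l hl c hcρ hc => ?_⟩
  obtain ⟨n, hn⟩ := hkm (g * L + l)
  refine ⟨n, hU' _ fun z hz => ?_⟩
  have := hf g hg l hl ‖c‖ (c / ‖c‖) (Ico_subset_Icc_self hcρ) (norm_div_norm_self hc.1)
    hc.2.1 hc.2.2 z (le_max_of_le_right hz)
  rw [mul_div_cancel₀ _ (by simpa using hc.1)] at this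
  rw [hn]
  exact this.trans (min_le_right _ _)

theorem dense_hittingSet_Icc (hm : StrictMono m) (hpos : ∀ n, 0 < m n)
    (hns : ¬ Summable fun n => 1 / (m n : ℝ)) (hU : IsOpen U) (hne : U.Nonempty) {a : ℝ}
    (ha : 0 < a) (b : ℝ) : Dense (hittingSet m ((fun t : ℝ => (t : ℂ)) '' Icc a b) U) := by
  refine dense_of_forall_ofPolynomial fun p R hR ε hε => ?_
  obtain ⟨δ, hδ, h⟩ := exists_radii_forall_rotations_mem hm hpos hns hU hne p hR ha hε b
  -- Positive reals all have direction 1, so one order per annulus and no rotation suffice.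
  obtain ⟨k, ρ, r, -, hρ0, hr, h⟩ := h 1 one_pos
  obtain ⟨f, hfp, hf⟩ := h (fun _ => 1) fun _ => norm_one
  refine ⟨f, ?_, hfp⟩
  rintro _ ⟨t, ht, rfl⟩
  have ht0 : 0 < t := ha.trans_le ht.1
  have hnorm : ‖(t : ℂ)‖ = t := by simp [ht0.le]
  obtain ⟨g, hg, htg⟩ := exists_lt_mem_Ico_of_lt (hρ0.trans_le ht.1) (ht.2.trans_lt hr)
  refine hf g hg 0 one_pos t (by rwa [hnorm]) ⟨by exact_mod_cast ht0.ne', ?_⟩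
  have htc : (t : ℂ) ≠ 0 := by exact_mod_cast ht0.ne'
  rw [hnorm, div_self htc]
  simp [hδ]

/-- The `f` for which the `c ∈ K` such that no `T c (m n) f` lies in `U` have measure less
than `η`, up to passing to compact subsets. -/
def almostHittingSet (m : ℕ → ℕ) (K : Set ℂ) (η : ℝ) (U : Set EntireFunctions) :
    Set EntireFunctions :=
  ⋃ K' ∈ {K' : Set ℂ | IsCompact K' ∧ volume.real (K \ K') < η}, hittingSet m K' U

theorem isOpen_almostHittingSet (K : Set ℂ) (η : ℝ) (hU : IsOpen U) :
    IsOpen (almostHittingSet m K η U) :=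
  isOpen_biUnion fun _ hK' => isOpen_hittingSet m hK'.1 hU

theorem dense_almostHittingSet (hm : StrictMono m) (hpos : ∀ n, 0 < m n)
    (hns : ¬ Summable fun n => 1 / (m n : ℝ)) (hU : IsOpen U) (hne : U.Nonempty) {a b η : ℝ}
    (ha : 0 < a) (hη : 0 < η) :
    Dense (almostHittingSet m {c | ‖c‖ ∈ Icc a b} η U) := by
  refine dense_of_forall_ofPolynomial fun p R hR ε hε => ?_
  set K : Set ℂ := {c | ‖c‖ ∈ Icc a b} with hK
  have hKm : MeasurableSet K := measurable_norm measurableSet_Icc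
  have hKfin : volume K ≠ ⊤ := ne_top_of_le_ne_top (isCompact_closedBall (0 : ℂ) b).measure_ne_top
    (measure_mono fun c hc => by simpa using hc.2)
  obtain ⟨δ, hδ, h⟩ := exists_radii_forall_rotations_mem hm hpos hns hU hne p hR ha hε b
  obtain ⟨θ, hθ0, hθ1, hθ⟩ := exists_measureReal_diff_directionSet_le hδ
  obtain ⟨L, hL0, hL⟩ : ∃ L > 0, θ ^ L * volume.real K < η / 2 := by
    have := ((tendsto_pow_atTop_nhds_zero_of_lt_one hθ0 hθ1).mul_const (volume.real K))
    rw [zero_mul] at this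
    exact ((eventually_gt_atTop 0).and (this.eventually_lt_const (half_pos hη))).exists
  obtain ⟨k, ρ, r, hρ, hρ0, hr, h⟩ := h L hL0
  set W : ℕ → Set ℂ := fun g => K ∩ {c | ‖c‖ ∈ Ico (ρ g) (ρ (g + 1))} with hW
  have hWm : ∀ g, MeasurableSet (W g) := fun g => hKm.inter (measurable_norm measurableSet_Ico)
  have hWfin : ∀ g, volume (W g) ≠ ⊤ := fun g =>
    ne_top_of_le_ne_top hKfin (measure_mono inter_subset_left)
  have hK0 : (0 : ℂ) ∉ K := fun h => absurd h.1 (by simpa using ha)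
  choose w hw hwW using fun g => exists_measureReal_diff_iUnion_directionSet_le hθ0 (hθ volume)
    (hWm g) (hWfin g) (fun h => hK0 h.1) (fun l => k (g * L + l)) L
  have hdiv : ∀ g, ∀ l < L, (g * L + l) / L = g ∧ (g * L + l) % L = l := fun g l hl =>
    ⟨by rw [mul_comm, Nat.mul_add_div hL0, Nat.div_eq_of_lt hl, add_zero],
      by rw [mul_comm, Nat.mul_add_mod, Nat.mod_eq_of_lt hl]⟩
  -- Index `i = g * L + l` encodes annulus `g` and its `l`-th rotation.
  obtain ⟨f, hfp, hf⟩ := h (fun i => w (i / L) (i % L)) fun i => hw _ _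
  set B : ℕ → Set ℂ := fun g => W g \ ⋃ l < L, directionSet δ (w g l) (k (g * L + l)) with hB
  have hBm : ∀ g, MeasurableSet (B g) := fun g =>
    (hWm g).diff (.iUnion fun l => .iUnion fun _ => measurableSet_directionSet _ _ _)
  set A : Set ℂ := K \ ⋃ g ∈ Finset.range r, B g with hA
  have hAm : MeasurableSet A := hKm.diff (Finset.measurableSet_biUnion _ fun g _ => hBm g)
  have hAfin : volume A ≠ ⊤ := ne_top_of_le_ne_top hKfin (measure_mono sdiff_subset)
  have hKA : volume.real (K \ A) < η / 2 := by
    refine lt_of_le_of_lt ?_ hL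
    have hdisj : Set.PairwiseDisjoint (Finset.range r : Set ℕ) W := by
      intro g _ g' _ hgg'
      refine Set.disjoint_left.mpr fun c hc hc' => hgg' ?_
      have h1 : ∀ {g g'}, c ∈ W g → c ∈ W g' → g ≤ g' := fun {g g'} h1 h2 => by
        by_contra! hlt
        exact absurd (h2.2.2.trans_le (hρ hlt)) (not_lt.mpr h1.2.1)
      exact le_antisymm (h1 hc hc') (h1 hc' hc)
    calc volume.real (K \ A) ≤ volume.real (⋃ g ∈ Finset.range r, B g) :=
          measureReal_mono (by rw [hA, Set.sdiff_sdiff_right_self]; exact inter_subset_right)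
            (measure_biUnion_lt_top (Finset.range r).finite_toSet fun g _ =>
              (measure_mono sdiff_subset).trans_lt (hWfin g).lt_top).ne
      _ ≤ ∑ g ∈ Finset.range r, volume.real (B g) := measureReal_biUnion_finset_le _ _
      _ ≤ ∑ g ∈ Finset.range r, θ ^ L * volume.real (W g) :=
          Finset.sum_le_sum fun g _ => hwW g
      _ = θ ^ L * volume.real (⋃ g ∈ Finset.range r, W g) := by
          rw [measureReal_biUnion_finset hdisj (fun g _ => hWm g) (fun g _ => hWfin g),
            Finset.mul_sum]
      _ ≤ θ ^ L * volume.real K := mul_le_mul_of_nonneg_left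
          (measureReal_mono (iUnion₂_subset fun g _ => inter_subset_left) hKfin)
          (pow_nonneg hθ0 L)
  -- Inner regularity spends the other half of `η`; compactness is what makes the hitting set open.
  obtain ⟨K', hK'A, hK', hAK'⟩ := hAm.exists_isCompact_sdiff_lt hAfin
    (ENNReal.ofReal_pos.mpr (half_pos hη)).ne'
  refine ⟨f, mem_biUnion (x := K') ⟨hK', ?_⟩ fun c hc => ?_, hfp⟩
  · have h1 : volume.real (A \ K') < η / 2 := by
      rw [measureReal_def]
      exact ENNReal.toReal_lt_of_lt_ofReal hAK'
    have h2 : K \ K' ⊆ (K \ A) ∪ (A \ K') := fun c hc => by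
      by_cases hcA : c ∈ A
      · exact Or.inr ⟨hcA, hc.2⟩
      · exact Or.inl ⟨hc.1, hcA⟩
    have h3 := (measureReal_mono h2 (measure_union_ne_top
      (ne_top_of_le_ne_top hKfin (measure_mono sdiff_subset))
      (ne_top_of_le_ne_top hAfin (measure_mono sdiff_subset)))).trans
      (measureReal_union_le (μ := volume) _ _)
    linarith
  · obtain ⟨hcK, hcB⟩ := hK'A hc
    obtain ⟨g, hg, hcg⟩ := exists_lt_mem_Ico_of_lt (hρ0.trans_le hcK.1) (hcK.2.trans_lt hr)
    have hcU : c ∈ ⋃ l < L, directionSet δ (w g l) (k (g * L + l)) := by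
      by_contra hcU
      exact hcB (mem_biUnion (Finset.mem_range.mpr hg) ⟨⟨hcK, hcg⟩, hcU⟩)
    obtain ⟨l, hl, hcl⟩ := mem_iUnion₂.mp hcU
    refine hf g hg l hl c hcg ?_
    rwa [(hdiv g l hl).1, (hdiv g l hl).2]

theorem mem_hypercyclicSet_of_forall_countableBasis {S : ℕ → EntireFunctions → EntireFunctions}
    {f : EntireFunctions}
    (h : ∀ U ∈ TopologicalSpace.countableBasis EntireFunctions, ∃ n, S n f ∈ U) :
    f ∈ hypercyclicSet S := by
  refine (TopologicalSpace.isBasis_countableBasis EntireFunctions).dense_iff.mpr fun U hU _ => ?_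
  obtain ⟨n, hn⟩ := h U hU
  exact ⟨_, hn, n, rfl⟩

theorem isResidualSet_iInter_hypercyclicSet (hm : StrictMono m) (hpos : ∀ n, 0 < m n)
    (hns : ¬ Summable fun n => 1 / (m n : ℝ)) :
    IsResidualSet (⋂ t ∈ Set.Ioi (0 : ℝ), hypercyclicSet (fun n => T (t : ℂ) (m n))) := by
  let V : TopologicalSpace.countableBasis EntireFunctions × ℕ → Set EntireFunctions := fun x =>
    hittingSet m ((fun t : ℝ => (t : ℂ)) '' Icc (1 / (x.2 + 1 : ℝ)) (x.2 + 1)) x.1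
  have hopen : ∀ x, IsOpen (V x) := fun x =>
    isOpen_hittingSet m (isCompact_Icc.image Complex.continuous_ofReal)
      (TopologicalSpace.isOpen_of_mem_countableBasis x.1.2)
  refine ⟨⋂ x, V x, fun f hf => ?_, .iInter_of_isOpen hopen, dense_iInter_of_isOpen hopen
    fun x => dense_hittingSet_Icc hm hpos hns
      (TopologicalSpace.isOpen_of_mem_countableBasis x.1.2)
      (TopologicalSpace.nonempty_of_mem_countableBasis x.1.2) (by positivity) _⟩
  refine mem_iInter₂.mpr fun t ht => mem_hypercyclicSet_of_forall_countableBasis fun U hU => ?_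
  have ht0 : 0 < t := ht
  obtain ⟨n, hn⟩ := exists_nat_ge (max t (1 / t))
  have h1 : t ≤ n + 1 := by linarith [le_max_left t (1 / t)]
  have h2 : 1 / t ≤ n + 1 := by linarith [le_max_right t (1 / t)]
  exact mem_iInter.mp hf (⟨U, hU⟩, n) t
    (mem_image_of_mem _ ⟨(one_div_le (by positivity) ht0).mpr h2, h1⟩)

theorem exists_nonempty_iInter_hypercyclicSet (hm : StrictMono m) (hpos : ∀ n, 0 < m n)
    (hns : ¬ Summable fun n => 1 / (m n : ℝ)) :
    ∃ I : Set ℂ, I ⊆ {0}ᶜ ∧ volume Iᶜ = 0 ∧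
      (⋂ c ∈ I, hypercyclicSet (fun n => T c (m n))).Nonempty := by
  let A : ℕ → Set ℂ := fun n => {c | ‖c‖ ∈ Icc (1 / (n + 1 : ℝ)) (n + 1)}
  let V : TopologicalSpace.countableBasis EntireFunctions × ℕ × ℕ → Set EntireFunctions :=
    fun x => almostHittingSet m (A x.2.1) (1 / (x.2.2 + 1 : ℝ)) x.1
  obtain ⟨f, hf⟩ : (⋂ x, V x).Nonempty := by
    refine (dense_iInter_of_isOpen (fun x => isOpen_almostHittingSet _ _
      (TopologicalSpace.isOpen_of_mem_countableBasis x.1.2))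
      fun x => dense_almostHittingSet hm hpos hns
        (TopologicalSpace.isOpen_of_mem_countableBasis x.1.2)
        (TopologicalSpace.nonempty_of_mem_countableBasis x.1.2)
        (by positivity) (by positivity)).nonempty_iff.mpr ⟨ofPolynomial 0⟩
  -- With `f` fixed, each exceptional set has measure below `1 / (j + 1)` for every `j`, and there
  -- are countably many of them.
  let B : TopologicalSpace.countableBasis EntireFunctions × ℕ → Set ℂ := fun x =>
    {c ∈ A x.2 | ∀ n, T c (m n) f ∉ x.1.1}
  have hB : ∀ x, volume (B x) = 0 := by
    intro x
    have hfin : volume (A x.2) ≠ ⊤ := ne_top_of_le_ne_top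
      (isCompact_closedBall (0 : ℂ) (x.2 + 1)).measure_ne_top
      (measure_mono fun c hc => by simpa using hc.2)
    have hBfin : volume (B x) ≠ ⊤ := ne_top_of_le_ne_top hfin (measure_mono fun c hc => hc.1)
    rw [← measureReal_eq_zero_iff hBfin]
    refine le_antisymm (le_of_forall_pos_le_add fun η hη => ?_) measureReal_nonneg
    obtain ⟨j, hj⟩ := exists_nat_one_div_lt hη
    obtain ⟨K', ⟨-, hK'⟩, hfK'⟩ := mem_iUnion₂.mp (mem_iInter.mp hf (x.1, x.2, j))
    rw [zero_add]
    refine (measureReal_mono (s₂ := A x.2 \ K') (fun c hc => ⟨hc.1, fun hcK' => ?_⟩)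
      (ne_top_of_le_ne_top hfin (measure_mono sdiff_subset))).trans (hK'.trans hj).le
    obtain ⟨n, hn⟩ := hfK' c hcK'
    exact hc.2 n hn
  refine ⟨({0} ∪ ⋃ x, B x)ᶜ, compl_subset_compl.mpr subset_union_left, ?_, f,
    mem_iInter₂.mpr fun c hc => mem_hypercyclicSet_of_forall_countableBasis fun U hU => ?_⟩
  · rw [compl_compl]
    exact measure_union_null (measure_singleton 0) (measure_iUnion_null hB)
  · by_contra! hcU
    have hc0 : 0 < ‖c‖ := norm_pos_iff.mpr fun h => hc (Or.inl h)
    obtain ⟨n, hn⟩ := exists_nat_ge (max ‖c‖ (1 / ‖c‖))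
    have h1 : ‖c‖ ≤ n + 1 := by linarith [le_max_left ‖c‖ (1 / ‖c‖)]
    have h2 : 1 / ‖c‖ ≤ n + 1 := by linarith [le_max_right ‖c‖ (1 / ‖c‖)]
    exact hc (Or.inr (mem_iUnion.mpr ⟨(⟨U, hU⟩, n),
      ⟨(one_div_le (by positivity) hc0).mpr h2, h1⟩, hcU⟩))

end EntireFunctions

/-! ### The convergent case. -/

namespace EntireFunctions

/-- Evaluation at 0 maps a dense orbit to a dense subset of `ℂ`, which stays dense after finitely
many values are removed. -/
theorem infinite_of_mem_hypercyclicSet {m : ℕ → ℕ} {c : ℂ} {f : EntireFunctions}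
    (h : f ∈ hypercyclicSet (fun n => T c (m n))) :
    {n | ‖c ^ m n * iteratedDeriv (m n) f.1 0 - 1‖ < 1 / 2}.Infinite := by
  have hev : Continuous fun g : EntireFunctions => g.1 0 :=
    (continuous_eval_const (F := C(ℂ, ℂ)) 0).comp continuous_subtype_val
  have hsurj : Function.Surjective fun g : EntireFunctions => g.1 0 := fun w =>
    ⟨of (fun _ => w) (differentiable_const w), rfl⟩
  have hd : Dense (range fun n => c ^ m n * iteratedDeriv (m n) f.1 0) := by
    have := hsurj.denseRange.dense_image hev h
    rw [← range_comp] at this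
    convert this using 3 with n
    simp [T_apply]
  intro hfin
  obtain ⟨w, hw, ⟨⟨n, rfl⟩, hn⟩⟩ := (hd.sdiff_finite (hfin.image
    fun n => c ^ m n * iteratedDeriv (m n) f.1 0)).inter_open_nonempty
    (ball 1 (1 / 2)) isOpen_ball ⟨1, mem_ball_self (by norm_num)⟩
  exact hn ⟨n, by simpa [dist_eq_norm] using hw, rfl⟩

theorem iInter_hypercyclicSet_Icc_eq_empty {m : ℕ → ℕ} (hpos : ∀ n, 0 < m n)
    (hs : Summable fun n => 1 / (m n : ℝ)) {θ₁ θ₂ : ℝ} (h₁ : 0 < θ₁) (h₂ : θ₁ < θ₂) :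
    (⋂ t ∈ Icc θ₁ θ₂, hypercyclicSet (fun n => T (t : ℂ) (m n))) = ∅ := by
  rw [eq_empty_iff_forall_notMem]
  intro f hf
  set y : ℕ → ℝ := fun n => Real.log ‖iteratedDeriv (m n) f.1 0‖ with hy
  -- A value within 1/2 of 1 has modulus in `(1/2, 3/2)`, whose logarithm is crudely at most 2 in
  -- absolute value.
  set J : ℕ → Set ℝ := fun n => closedBall (-(y n / m n)) (2 * (1 / m n)) with hJ
  have hJv : ∀ n, volume (J n) = ENNReal.ofReal (4 * (1 / (m n : ℝ))) := fun n => by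
    rw [hJ, Real.volume_closedBall]
    ring_nf
  have hlim : volume (limsup J atTop) = 0 := by
    refine measure_limsup_atTop_eq_zero ?_
    simp only [hJv]
    exact (hs.mul_left 4).tsum_ofReal_ne_top
  have hsub : Icc (Real.log θ₁) (Real.log θ₂) ⊆ limsup J atTop := by
    intro x hx
    have ht : Real.exp x ∈ Icc θ₁ θ₂ :=
      ⟨(Real.log_le_iff_le_exp h₁).mp hx.1, (Real.le_log_iff_exp_le (h₁.trans h₂)).mp hx.2⟩
    have hinf := infinite_of_mem_hypercyclicSet (mem_iInter₂.mp hf _ ht)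
    rw [← Nat.frequently_atTop_iff_infinite] at hinf
    rw [mem_limsup_iff_frequently_mem]
    refine hinf.mono fun n hn => ?_
    have hm : (0 : ℝ) < m n := by exact_mod_cast hpos n
    set d := iteratedDeriv (m n) f.1 0 with hd
    have hN : ‖(Real.exp x : ℂ) ^ m n * d‖ = Real.exp (m n * x) * ‖d‖ := by
      rw [norm_mul, norm_pow, Complex.norm_real, Real.norm_eq_abs, Real.abs_exp, Real.exp_nat_mul]
    have hlow : 1 / 2 < Real.exp (m n * x) * ‖d‖ := by
      have := norm_sub_norm_le (1 : ℂ) (1 - (Real.exp x : ℂ) ^ m n * d)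
      rw [sub_sub_cancel, hN, norm_one, norm_sub_rev] at this
      have hn' : ‖(Real.exp x : ℂ) ^ m n * d - 1‖ < 1 / 2 := hn
      linarith
    have hupp : Real.exp (m n * x) * ‖d‖ < 3 / 2 := by
      have := norm_sub_norm_le ((Real.exp x : ℂ) ^ m n * d) 1
      rw [hN, norm_one] at this
      have hn' : ‖(Real.exp x : ℂ) ^ m n * d - 1‖ < 1 / 2 := hn
      linarith
    have hd0 : 0 < ‖d‖ := by
      by_contra! h
      have := mul_nonpos_of_nonneg_of_nonpos (Real.exp_pos (m n * x)).le h
      linarith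
    have hlog : Real.log (Real.exp (m n * x) * ‖d‖) = m n * x + y n := by
      rw [Real.log_mul (Real.exp_pos _).ne' hd0.ne', Real.log_exp]
    have hl1 : -2 ≤ m n * x + y n := by
      rw [← hlog]
      have h4 := Real.one_sub_inv_le_log_of_pos ((by norm_num : (0 : ℝ) < 1 / 2).trans hlow)
      have h5 := inv_anti₀ (by norm_num) hlow.le
      rw [one_div, inv_inv] at h5
      linarith
    have hl2 : m n * x + y n ≤ 2 := by
      rw [← hlog]
      have h4 := Real.log_le_sub_one_of_pos ((by norm_num : (0 : ℝ) < 1 / 2).trans hlow)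
      linarith
    rw [hJ, mem_closedBall, Real.dist_eq, abs_le, sub_neg_eq_add, mul_one_div,
      ← neg_div, show x + y n / m n = (m n * x + y n) / m n by field_simp]
    exact ⟨by gcongr, by gcongr⟩
  have hzero := measure_mono_null hsub hlim
  rw [Real.volume_Icc, ENNReal.ofReal_eq_zero, sub_nonpos] at hzero
  exact absurd (Real.log_lt_log h₁ h₂) (not_lt.mpr hzero)

end EntireFunctions

theorem mainTheorem3 (m : ℕ → ℕ) (hm : StrictMono m) (hpos : ∀ n, 0 < m n) :
    (Summable (fun n => 1 / (m n : ℝ)) →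
      ∀ θ₁ θ₂ : ℝ, 0 < θ₁ → θ₁ < θ₂ →
        (⋂ t ∈ Set.Icc θ₁ θ₂, hypercyclicSet (fun n => EntireFunctions.T (t : ℂ) (m n))) = ∅) ∧
    (¬ Summable (fun n => 1 / (m n : ℝ)) →
      IsResidualSet
        (⋂ t ∈ Set.Ioi (0 : ℝ), hypercyclicSet (fun n => EntireFunctions.T (t : ℂ) (m n)))) ∧
    (¬ Summable (fun n => 1 / (m n : ℝ)) →
      ∃ I : Set ℂ, I ⊆ {0}ᶜ ∧ MeasureTheory.volume Iᶜ = 0 ∧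
        (⋂ c ∈ I, hypercyclicSet (fun n => EntireFunctions.T c (m n))).Nonempty) := by
  exact ⟨fun hs _ _ h₁ h₂ => EntireFunctions.iInter_hypercyclicSet_Icc_eq_empty hpos hs h₁ h₂,
    EntireFunctions.isResidualSet_iInter_hypercyclicSet hm hpos,
    EntireFunctions.exists_nonempty_iInter_hypercyclicSet hm hpos⟩
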